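/- Let $n,k$ be natural numbers and let $H$ be a $k$-dimensional linear subspace of $\mathbb{R}^n$ such that $e_j\notin H\cup H^\perp$ for every $1\le j\le n$, where $e_1,\dots,e_n$ is the standard basis. Write $B_1^m=\{x\in\mathbb{R}^m:\sum_{i=1}^m|x_i|\le 1\}$, let $\mathrm{vol}_k$ be $k$-dimensional Lebesgue measure (on $H$ with respect to its Euclidean structure), let $P_{H^\perp}$ be the orthogonal projection onto $H^\perp$, and let $\|\cdot\|_2$ be the Euclidean norm. Then $$\mathrm{vol}_k(B_1^n\cap H)\;\le\;\mathrm{vol}_k(B_1^k)\,\frac{1}{\pi^{\frac{n-k}{2}}}\prod_{j=1}^n\left(\frac{\Gamma\!\left(\frac{1}{\|P_{H^\perp}e_j\|_2^2}-\frac12\right)}{\|P_{H^\perp}e_j\|_2\,\Gamma\!\left(\frac{1}{\|P_{H^\perp}e_j\|_2^2}\right)}\right)^{\|P_{H^\perp}e_j\|_2^2}\;\le\;\mathrm{vol}_k(B_1^k).$$ -/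

import Mathlib

open scoped MeasureTheory

/-- The closed unit ball `B_1^n` of the `ℓ_1`-norm, as a subset of Euclidean space `ℝⁿ`. -/
def crossPolytope (n : ℕ) : Set (EuclideanSpace ℝ (Fin n)) :=
  {x | ∑ i, |x i| ≤ 1}

/-- The Euclidean length `‖P_{H^⊥} e_j‖₂` of the orthogonal projection of the `j`-th standard
basis vector onto the orthogonal complement of `H`. -/
noncomputable def projPerpNorm {n : ℕ} (H : Submodule ℝ (EuclideanSpace ℝ (Fin n)))
    (j : Fin n) : ℝ :=
  ‖Hᗮ.starProjection (EuclideanSpace.single j (1 : ℝ))‖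

/-- The real number
`π^{-(n-k)/2} ∏_j (Γ(1/d_j² - 1/2) / (d_j Γ(1/d_j²)))^{d_j²}` with `d_j = ‖P_{H^⊥} e_j‖₂`. -/
noncomputable def sectionFactor {n : ℕ} (k : ℕ)
    (H : Submodule ℝ (EuclideanSpace ℝ (Fin n))) : ℝ :=
  1 / Real.pi ^ (((n : ℝ) - (k : ℝ)) / 2) *
    ∏ j : Fin n,
      (Real.Gamma (1 / projPerpNorm H j ^ 2 - 1 / 2) /
        (projPerpNorm H j * Real.Gamma (1 / projPerpNorm H j ^ 2))) ^ (projPerpNorm H j ^ 2)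

/-! Integrating `exp (-‖x‖₁)` over level sets gives `vol_k(B_1^n ∩ H) = (1/k!) ∫_H exp (-‖x‖₁)` and
`vol_k(B_1^k) = 2^k/k!`. Fourier inversion at `0` for the marginal of `exp (-‖x‖₁)` on `Hᗮ` turns
the integral over `H` into `∫_{Hᗮ} ∏ 2/(1 + (2π w_j)²) dw` (`integral_expNegL1_coe`).

Here `w_j = ⟨P e_j, w⟩`, and the vectors `P e_j` form a Parseval frame of `Hᗮ` with lengths `d_j`.
Writing the factors as `d_j²`-th powers, the geometric Brascamp-Lieb inequality
(`lintegral_prod_rpow_le_of_parseval`) bounds the integral by one-dimensional integrals `∫ (1 +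
x²)^(-1/d_j²)`, which are Gamma quotients. Since `∑ d_j² = n - k`, the powers of `2` and `π` come
out as stated.

For the second inequality, every factor of the product is at most `1` by Bernoulli
(`sqrt_pi_mul_gamma_div_le_pi`). -/

/-! ### Monotone transport on the line. -/

open MeasureTheory Filter Topology Set in
/-- The distribution function of a positive continuous integrable density is a `C¹` increasing
bijection onto `(0, ∫ f)`. -/
theorem exists_hasDerivAt_range_eq_Ioo {f : ℝ → ℝ} (hc : Continuous f) (hpos : ∀ x, 0 < f x)
    (hi : Integrable f) :
    ∃ F : ℝ → ℝ, (∀ x, HasDerivAt F (f x) x) ∧ range F = Ioo 0 (∫ x, f x) := by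
  -- Adding this constant makes the primitive tend to `0` at `-∞`.
  set A := ∫ x in Iic (0 : ℝ), f x with hA
  let F : ℝ → ℝ := fun x => A + ∫ t in (0 : ℝ)..x, f t
  have hF : ∀ x, HasDerivAt F (f x) x := fun x =>
    (intervalIntegral.integral_hasDerivAt_right (hc.intervalIntegrable _ _)
      (hc.stronglyMeasurableAtFilter _ _) hc.continuousAt).const_add A
  have hmono : StrictMono F := strictMono_of_deriv_pos fun x => by rw [(hF x).deriv]; exact hpos x
  have htop : Tendsto F atTop (𝓝 (∫ x, f x)) := by
    rw [← intervalIntegral.integral_Iic_add_Ioi (b := (0 : ℝ)) hi.integrableOn hi.integrableOn]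
    exact (intervalIntegral_tendsto_integral_Ioi 0 hi.integrableOn tendsto_id).const_add A
  have hbot : Tendsto F atBot (𝓝 0) := by
    have h := (intervalIntegral_tendsto_integral_Iic 0 hi.integrableOn tendsto_id).const_sub A
    rw [sub_self] at h
    refine h.congr fun x => ?_
    simp only [F, id, intervalIntegral.integral_symm x 0]
    ring
  refine ⟨F, hF, ?_⟩
  have hcont : Continuous F := continuous_iff_continuousAt.2 fun x => (hF x).continuousAt
  apply Subset.antisymm
  · rintro _ ⟨x, rfl⟩
    refine ⟨?_, ?_⟩
    · exact (hmono.monotone.le_of_tendsto hbot (x - 1)).trans_lt (hmono (by linarith))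
    · exact (hmono (by linarith : x < x + 1)).trans_le (hmono.monotone.ge_of_tendsto htop (x + 1))
  · intro y hy
    exact mem_range_of_exists_le_of_exists_ge hcont
      ((hbot.eventually (eventually_le_nhds hy.1)).exists)
      ((htop.eventually (eventually_ge_nhds hy.2)).exists)

open MeasureTheory Filter Topology Set in
/-- Monotone transport between positive continuous densities of equal mass. -/
theorem exists_monotone_transport {f g : ℝ → ℝ} (hfc : Continuous f) (hfpos : ∀ x, 0 < f x)
    (hfi : Integrable f) (hgc : Continuous g) (hgpos : ∀ x, 0 < g x) (hgi : Integrable g)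
    (hfg : ∫ x, f x = ∫ x, g x) :
    ∃ S S' : ℝ → ℝ, (∀ x, HasDerivAt S (S' x) x) ∧ (∀ x, 0 < S' x) ∧
      ∀ x, f x = g (S x) * S' x := by
  obtain ⟨F, hF, hFr⟩ := exists_hasDerivAt_range_eq_Ioo hfc hfpos hfi
  obtain ⟨G, hG, hGr⟩ := exists_hasDerivAt_range_eq_Ioo hgc hgpos hgi
  have hr : range F = range G := by rw [hFr, hGr, hfg]
  have hFm : StrictMono F := strictMono_of_deriv_pos fun x => by rw [(hF x).deriv]; exact hfpos x
  have hGm : StrictMono G := strictMono_of_deriv_pos fun x => by rw [(hG x).deriv]; exact hgpos x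
  have hex : ∀ x, ∃ y, G y = F x := fun x => by
    have : F x ∈ range G := hr ▸ mem_range_self x
    exact this
  choose S hS using hex
  have hSm : StrictMono S := fun x y hxy => by
    rw [← hGm.lt_iff_lt, hS, hS]; exact hFm hxy
  have hSs : Function.Surjective S := fun y => by
    obtain ⟨x, hx⟩ : G y ∈ range F := hr ▸ mem_range_self y
    exact ⟨x, hGm.injective (by rw [hS, hx])⟩
  have hSc : Continuous S := hSm.monotone.continuous_of_surjective hSs
  refine ⟨S, fun x => f x / g (S x), fun x => ?_, fun x => div_pos (hfpos _) (hgpos _),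
    fun x => by field_simp [(hgpos (S x)).ne']⟩
  -- Since `G ∘ S = F`, the slope of `S` is the slope of `F` divided by that of `G` between the
  -- image points; both converge because `S` is continuous and injective.
  rw [hasDerivAt_iff_tendsto_slope]
  have h1 := hasDerivAt_iff_tendsto_slope.1 (hF x)
  have h2 := hasDerivAt_iff_tendsto_slope.1 (hG (S x))
  have h3 : Tendsto S (𝓝[≠] x) (𝓝[≠] (S x)) :=
    tendsto_nhdsWithin_of_tendsto_nhds_of_eventually_within _
      (hSc.continuousAt.tendsto.mono_left nhdsWithin_le_nhds)
      (eventually_mem_nhdsWithin.mono fun y hy => hSm.injective.ne hy)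
  refine (h1.div (h2.comp h3) (hgpos _).ne').congr' ?_
  filter_upwards [self_mem_nhdsWithin] with y hy
  have hy1 : y - x ≠ 0 := sub_ne_zero.2 hy
  have hy2 : S y - S x ≠ 0 := sub_ne_zero.2 (hSm.injective.ne hy)
  have hy3 : F y - F x ≠ 0 := sub_ne_zero.2 (hFm.injective.ne hy)
  simp only [Pi.div_apply, Function.comp, slope_def_field, hS]
  field_simp

/-! ### Integrals of powers of `1 + x²`. -/

theorem continuous_one_add_sq_rpow (q : ℝ) : Continuous fun x : ℝ => (1 + x ^ 2) ^ q :=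
  Continuous.rpow_const (by fun_prop) fun x => Or.inl (by positivity)

-- Expand `Γ(p) (1 + x²)^(-p) = ∫₀^∞ t^(p-1) e^(-(1+x²)t) dt` and apply Tonelli: the Gaussian
-- integral in `x` contributes `√π t^(-1/2)`, which leaves `Γ(p - 1/2)`. In `ℝ≥0∞` no prior
-- integrability is needed; it follows from finiteness.
open MeasureTheory Set in
theorem lintegral_one_add_sq_rpow_neg {p : ℝ} (hp : 1 / 2 < p) :
    ∫⁻ x : ℝ, ENNReal.ofReal ((1 + x ^ 2) ^ (-p)) =
      ENNReal.ofReal (√Real.pi * Real.Gamma (p - 1 / 2) / Real.Gamma p) := by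
  have hp0 : 0 < p := by linarith
  have hG : 0 < Real.Gamma p := Real.Gamma_pos_of_pos hp0
  have key : ∀ (a r : ℝ), 0 < a → 0 < r →
      ∫⁻ t in Ioi (0 : ℝ), ENNReal.ofReal (t ^ (a - 1) * Real.exp (-(r * t))) =
        ENNReal.ofReal ((1 / r) ^ a * Real.Gamma a) := by
    intro a r ha hr
    rw [← Real.integral_rpow_mul_exp_neg_mul_Ioi ha hr, ofReal_integral_eq_lintegral_ofReal]
    -- A non-integrable function has Bochner integral `0`, whereas this one is positive.
    · by_contra h
      have := Real.integral_rpow_mul_exp_neg_mul_Ioi ha hr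
      rw [integral_undef h] at this
      have : 0 < (1 / r) ^ a * Real.Gamma a :=
        mul_pos (Real.rpow_pos_of_pos (by positivity) _) (Real.Gamma_pos_of_pos ha)
      linarith
    · filter_upwards [ae_restrict_mem measurableSet_Ioi] with t ht
      have : 0 < t := ht
      positivity
  have hgauss : ∀ t : ℝ, 0 < t →
      ∫⁻ x : ℝ, ENNReal.ofReal (Real.exp (-t * x ^ 2)) = ENNReal.ofReal √(Real.pi / t) := by
    intro t ht
    rw [← integral_gaussian, ofReal_integral_eq_lintegral_ofReal (integrable_exp_neg_mul_sq ht)]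
    exact Filter.Eventually.of_forall fun x => (Real.exp_pos _).le
  have h1 : ENNReal.ofReal (Real.Gamma p) * ∫⁻ x : ℝ, ENNReal.ofReal ((1 + x ^ 2) ^ (-p)) =
      ENNReal.ofReal (√Real.pi * Real.Gamma (p - 1 / 2)) := by
    rw [← lintegral_const_mul _ (by fun_prop)]
    calc ∫⁻ x : ℝ, ENNReal.ofReal (Real.Gamma p) * ENNReal.ofReal ((1 + x ^ 2) ^ (-p))
        = ∫⁻ x : ℝ, ∫⁻ t in Ioi (0 : ℝ),
            ENNReal.ofReal (t ^ (p - 1) * Real.exp (-((1 + x ^ 2) * t))) := by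
          refine lintegral_congr fun x => ?_
          rw [key p _ hp0 (by positivity), ← ENNReal.ofReal_mul hG.le, one_div,
            Real.inv_rpow (by positivity), Real.rpow_neg (by positivity), mul_comm]
      _ = ∫⁻ t in Ioi (0 : ℝ), ∫⁻ x : ℝ,
            ENNReal.ofReal (t ^ (p - 1) * Real.exp (-((1 + x ^ 2) * t))) := by
          apply lintegral_lintegral_swap
          apply Measurable.aemeasurable
          apply ENNReal.measurable_ofReal.comp
          apply Measurable.mul
          · exact measurable_snd.pow_const _
          · fun_prop
      _ = ∫⁻ t in Ioi (0 : ℝ), ENNReal.ofReal √Real.pi *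
            ENNReal.ofReal (t ^ (p - 1 / 2 - 1) * Real.exp (-(1 * t))) := by
          refine setLIntegral_congr_fun measurableSet_Ioi fun t ht => ?_
          have ht : 0 < t := ht
          have : ∀ x : ℝ, ENNReal.ofReal (t ^ (p - 1) * Real.exp (-((1 + x ^ 2) * t))) =
              ENNReal.ofReal (t ^ (p - 1) * Real.exp (-t)) *
                ENNReal.ofReal (Real.exp (-t * x ^ 2)) := by
            intro x
            rw [← ENNReal.ofReal_mul (by positivity), mul_assoc, ← Real.exp_add]
            ring_nf
          simp only [this]
          rw [lintegral_const_mul _ (by fun_prop), hgauss t ht, ← ENNReal.ofReal_mul (by positivity),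
            ← ENNReal.ofReal_mul (by positivity), Real.sqrt_div Real.pi_pos.le,
            show p - 1 / 2 - 1 = (p - 1) - 1 / 2 by ring, Real.rpow_sub ht _ (1 / 2),
            ← Real.sqrt_eq_rpow, one_mul]
          congr 1
          ring
      _ = _ := by
          rw [lintegral_const_mul _ (by fun_prop), key _ 1 (by linarith) one_pos,
            ← ENNReal.ofReal_mul (by positivity)]
          simp
  rw [ENNReal.ofReal_div_of_pos hG, ← h1, mul_comm, mul_div_assoc,
    ENNReal.div_self (by simpa using hG) ENNReal.ofReal_ne_top, mul_one]

open MeasureTheory in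
theorem integrable_one_add_sq_rpow_neg {p : ℝ} (hp : 1 / 2 < p) :
    Integrable fun x : ℝ => (1 + x ^ 2) ^ (-p) := by
  refine ⟨(continuous_one_add_sq_rpow _).aestronglyMeasurable, ?_⟩
  rw [hasFiniteIntegral_iff_ofReal (Filter.Eventually.of_forall fun x => by positivity),
    lintegral_one_add_sq_rpow_neg hp]
  exact ENNReal.ofReal_lt_top

open MeasureTheory in
theorem integral_one_add_sq_rpow_neg {p : ℝ} (hp : 1 / 2 < p) :
    ∫ x : ℝ, (1 + x ^ 2) ^ (-p) = √Real.pi * Real.Gamma (p - 1 / 2) / Real.Gamma p := by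
  rw [integral_eq_lintegral_of_nonneg_ae (Filter.Eventually.of_forall fun x => by positivity)
    (continuous_one_add_sq_rpow _).aestronglyMeasurable, lintegral_one_add_sq_rpow_neg hp, ENNReal.toReal_ofReal]
  have := Real.Gamma_pos_of_pos (by linarith : 0 < p)
  have := Real.Gamma_pos_of_pos (by linarith : 0 < p - 1 / 2)
  positivity

open MeasureTheory in
/-- Bernoulli's inequality gives `∫ (1 + d² x²)^(-1/d²) dx ≤ ∫ (1 + x²)⁻¹ dx` for `d ≤ 1`. -/
theorem sqrt_pi_mul_gamma_div_le_pi {d : ℝ} (hd : 0 < d) (hd1 : d ≤ 1) :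
    √Real.pi * (Real.Gamma (1 / d ^ 2 - 1 / 2) / (d * Real.Gamma (1 / d ^ 2))) ≤ Real.pi := by
  have hd2 : 0 < d ^ 2 := by positivity
  have hp1 : 1 ≤ 1 / d ^ 2 := by
    rw [le_div_iff₀ hd2]; nlinarith
  have hp : 1 / 2 < 1 / d ^ 2 := by linarith
  have hint : Integrable fun x : ℝ => (1 + (d * x) ^ 2) ^ (-(1 / d ^ 2)) :=
    (integrable_one_add_sq_rpow_neg hp).comp_mul_left' hd.ne'
  calc √Real.pi * (Real.Gamma (1 / d ^ 2 - 1 / 2) / (d * Real.Gamma (1 / d ^ 2)))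
      = ∫ x : ℝ, (1 + (d * x) ^ 2) ^ (-(1 / d ^ 2)) := by
        rw [Measure.integral_comp_mul_left (fun x : ℝ => (1 + x ^ 2) ^ (-(1 / d ^ 2))) d,
          integral_one_add_sq_rpow_neg hp, abs_of_pos (by positivity), smul_eq_mul]
        field_simp
    _ ≤ ∫ x : ℝ, (1 + x ^ 2)⁻¹ := by
        refine integral_mono hint integrable_inv_one_add_sq fun x => ?_
        simp only
        rw [Real.rpow_neg (by positivity)]
        refine inv_anti₀ (by positivity) ?_
        have := one_add_mul_self_le_rpow_one_add (s := (d * x) ^ 2) (by nlinarith [sq_nonneg (d * x)])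
          hp1
        calc 1 + x ^ 2 = 1 + 1 / d ^ 2 * (d * x) ^ 2 := by field_simp
          _ ≤ _ := this
    _ = Real.pi := integral_univ_inv_one_add_sq

/-! ### Parseval frames and the geometric Brascamp-Lieb inequality. -/

section ParsevalFrame

variable {ι E : Type*} [Fintype ι] [NormedAddCommGroup E] [InnerProductSpace ℝ E]

/-- The synthesis map is adjoint to an isometry, hence a contraction. Concretely, `‖y‖² = ∑ a_j
⟨v_j, y⟩ ≤ (∑ a_j² + ‖y‖²)/2`. -/
theorem norm_sq_sum_smul_le_of_parseval {v : ι → E}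
    (hv : ∀ w, ∑ j, inner ℝ (v j) w ^ 2 = ‖w‖ ^ 2) (a : ι → ℝ) :
    ‖∑ j, a j • v j‖ ^ 2 ≤ ∑ j, a j ^ 2 := by
  set y := ∑ j, a j • v j with hy
  have h1 : ‖y‖ ^ 2 = ∑ j, a j * inner ℝ (v j) y := by
    rw [← real_inner_self_eq_norm_sq]
    conv_lhs => rw [hy, sum_inner]
    simp only [real_inner_smul_left, hy]
  have h2 : ∑ j, a j * inner ℝ (v j) y ≤ ∑ j, (a j ^ 2 + inner ℝ (v j) y ^ 2) / 2 :=
    Finset.sum_le_sum fun j _ => by nlinarith [sq_nonneg (a j - inner ℝ (v j) y)]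
  rw [← Finset.sum_div, Finset.sum_add_distrib, hv] at h2
  linarith

/-- The frame operator `w ↦ ∑ j, t j ⟨v j, w⟩ v j`. -/
noncomputable def weightedFrameOperator (v : ι → E) (t : ι → ℝ) : E →L[ℝ] E :=
  ∑ j, t j • (innerSL ℝ (v j)).smulRight (v j)

theorem weightedFrameOperator_apply (v : ι → E) (t : ι → ℝ) (w : E) :
    weightedFrameOperator v t w = ∑ j, (t j * inner ℝ (v j) w) • v j := by
  simp [weightedFrameOperator, smul_smul]

theorem inner_weightedFrameOperator (v : ι → E) (t : ι → ℝ) (x y : E) :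
    inner ℝ (weightedFrameOperator v t x) y =
      ∑ j, t j * inner ℝ (v j) x * inner ℝ (v j) y := by
  simp [weightedFrameOperator_apply, sum_inner, real_inner_smul_left]

/-- In an orthonormal eigenbasis `b`, the `i`-th eigenvalue is the mean of the `t j` with weights
`⟨v_j, b_i⟩²`, which sum to `1` over `j` by the Parseval identity. Apply AM-GM to each eigenvalue
and multiply; summed over `i`, the weights give `‖v_j‖²`. -/
theorem prod_rpow_le_det_weightedFrameOperator [FiniteDimensional ℝ E] {v : ι → E}
    (hv : ∀ w, ∑ j, inner ℝ (v j) w ^ 2 = ‖w‖ ^ 2) {t : ι → ℝ} (ht : ∀ j, 0 < t j) :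
    ∏ j, t j ^ (‖v j‖ ^ 2) ≤ (weightedFrameOperator v t).det := by
  set A := weightedFrameOperator v t with hA
  have hsymm : (A : E →ₗ[ℝ] E).IsSymmetric := fun x y => by
    simp only [ContinuousLinearMap.coe_coe]
    rw [real_inner_comm _ x, hA, inner_weightedFrameOperator, inner_weightedFrameOperator]
    exact Finset.sum_congr rfl fun j _ => by ring
  set m := Module.finrank ℝ E with hm
  let b := hsymm.eigenvectorBasis hm.symm
  have hdet : A.det = ∏ i, hsymm.eigenvalues hm.symm i := by
    have := hsymm.det_eq_prod_eigenvalues hm.symm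
    simpa using this
  have hb : ∀ i, ∑ j, inner ℝ (v j) (b i) ^ 2 = 1 := fun i => by
    rw [hv, b.orthonormal.1 i]; norm_num
  have hlam : ∀ i, hsymm.eigenvalues hm.symm i = ∑ j, inner ℝ (v j) (b i) ^ 2 * t j := fun i => by
    have h1 : inner ℝ (A (b i)) (b i) = hsymm.eigenvalues hm.symm i := by
      have := hsymm.apply_eigenvectorBasis hm.symm i
      simp only [ContinuousLinearMap.coe_coe] at this
      rw [this, real_inner_smul_left, real_inner_self_eq_norm_sq]
      have := b.orthonormal.1 i
      simp only [b] at this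
      rw [this]; simp
    rw [← h1, hA, inner_weightedFrameOperator]
    exact Finset.sum_congr rfl fun j _ => by ring
  have hle : ∀ i, ∏ j, t j ^ (inner ℝ (v j) (b i) ^ 2) ≤ hsymm.eigenvalues hm.symm i := fun i => by
    rw [hlam]
    exact Real.geom_mean_le_arith_mean_weighted _ _ _ (fun j _ => sq_nonneg _) (hb i)
      (fun j _ => (ht j).le)
  rw [hdet]
  calc ∏ j, t j ^ (‖v j‖ ^ 2) = ∏ j, ∏ i, t j ^ (inner ℝ (v j) (b i) ^ 2) := by
        refine Finset.prod_congr rfl fun j _ => ?_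
        rw [← b.sum_sq_inner_left (v j), Real.rpow_sum_of_pos (ht j)]
    _ = ∏ i, ∏ j, t j ^ (inner ℝ (v j) (b i) ^ 2) := Finset.prod_comm
    _ ≤ _ := Finset.prod_le_prod
        (fun i _ => Finset.prod_nonneg fun j _ => Real.rpow_nonneg (ht j).le _) fun i _ => hle i

open MeasureTheory in
theorem lintegral_exp_neg_pi_mul_norm_sq [FiniteDimensional ℝ E] [MeasurableSpace E]
    [BorelSpace E] : ∫⁻ x : E, ENNReal.ofReal (Real.exp (-Real.pi * ‖x‖ ^ 2)) = 1 := by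
  have h := GaussianFourier.integral_rexp_neg_mul_sq_norm (V := E) Real.pi_pos
  rw [div_self Real.pi_ne_zero, Real.one_rpow] at h
  rw [← ofReal_integral_eq_lintegral_ofReal _ (Filter.Eventually.of_forall fun x =>
    (Real.exp_pos _).le), h, ENNReal.ofReal_one]
  by_contra hn
  rw [integral_undef hn] at h
  exact zero_ne_one h

-- Change variables by `Θ x = ∑ S_j(⟨v_j, x⟩) v_j`. Its derivative is a weighted frame operator,
-- whose determinant dominates the product of the `S'` powers, and the contraction bound controls
-- `‖Θ x‖²`. An injective `Θ` suffices: the Gaussian mass of its image is at most `1`.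
open MeasureTheory in
theorem lintegral_prod_exp_mul_rpow_le_one [FiniteDimensional ℝ E] [MeasurableSpace E]
    [BorelSpace E] {v : ι → E} (hv : ∀ w, ∑ j, inner ℝ (v j) w ^ 2 = ‖w‖ ^ 2)
    {S S' : ι → ℝ → ℝ} (hS : ∀ j s, HasDerivAt (S j) (S' j s) s) (hpos : ∀ j s, 0 < S' j s) :
    ∫⁻ x : E, ENNReal.ofReal (∏ j, (Real.exp (-Real.pi * S j (inner ℝ (v j) x) ^ 2) *
      S' j (inner ℝ (v j) x) ^ (‖v j‖ ^ 2))) ≤ 1 := by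
  let Θ : E → E := fun x => ∑ j, S j (inner ℝ (v j) x) • v j
  let D : E → E →L[ℝ] E := fun x => weightedFrameOperator v fun j => S' j (inner ℝ (v j) x)
  have hmono : ∀ j, StrictMono (S j) := fun j =>
    strictMono_of_deriv_pos fun x => by rw [(hS j x).deriv]; exact hpos j x
  have hD : ∀ x, HasFDerivAt Θ (D x) x := fun x => by
    refine HasFDerivAt.fun_sum fun j _ => ?_
    have h1 : HasFDerivAt (fun x => inner ℝ (v j) x) (innerSL ℝ (v j)) x :=
      (innerSL ℝ (v j)).hasFDerivAt
    have h2 := ((hS j (inner ℝ (v j) x)).comp_hasFDerivAt x h1).smul_const (v j)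
    exact h2.congr_fderiv (by ext w; simp [smul_smul])
  -- Pairing `Θ x - Θ y` with `x - y` gives a sum of nonnegative terms; if it vanishes, strict
  -- monotonicity kills every `⟨v_j, x - y⟩`, hence `x - y`.
  have hinj : Function.Injective Θ := fun x y hxy => by
    have h0 : ∑ j, (S j (inner ℝ (v j) x) - S j (inner ℝ (v j) y)) *
        (inner ℝ (v j) x - inner ℝ (v j) y) = 0 := by
      have : inner ℝ (Θ x - Θ y) (x - y) = 0 := by rw [hxy, sub_self, inner_zero_left]
      rw [← this]
      simp only [Θ, ← Finset.sum_sub_distrib, ← sub_smul, sum_inner, real_inner_smul_left,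
        inner_sub_right, mul_sub]
    have hnn : ∀ j ∈ Finset.univ, 0 ≤ (S j (inner ℝ (v j) x) - S j (inner ℝ (v j) y)) *
        (inner ℝ (v j) x - inner ℝ (v j) y) := fun j _ => by
      rcases le_total (inner ℝ (v j) x) (inner ℝ (v j) y) with h | h
      · exact mul_nonneg_of_nonpos_of_nonpos (sub_nonpos.2 ((hmono j).monotone h)) (sub_nonpos.2 h)
      · exact mul_nonneg (sub_nonneg.2 ((hmono j).monotone h)) (sub_nonneg.2 h)
    have heq : ∀ j, inner ℝ (v j) (x - y) = 0 := fun j => by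
      rw [inner_sub_right]
      rcases mul_eq_zero.1 ((Finset.sum_eq_zero_iff_of_nonneg hnn).1 h0 j (Finset.mem_univ j)) with
        h | h
      · rw [(hmono j).injective (sub_eq_zero.1 h), sub_self]
      · exact h
    have : ‖x - y‖ ^ 2 = 0 := by rw [← hv]; simp [heq]
    exact sub_eq_zero.1 (norm_eq_zero.1 (pow_eq_zero_iff two_ne_zero |>.1 this))
  calc _ ≤ ∫⁻ x : E, ENNReal.ofReal |(D x).det| *
        ENNReal.ofReal (Real.exp (-Real.pi * ‖Θ x‖ ^ 2)) := by
        refine lintegral_mono fun x => ?_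
        rw [← ENNReal.ofReal_mul (abs_nonneg _)]
        refine ENNReal.ofReal_le_ofReal ?_
        rw [Finset.prod_mul_distrib, ← Real.exp_sum, ← Finset.mul_sum, mul_comm]
        refine mul_le_mul ?_ ?_ (Real.exp_pos _).le (abs_nonneg _)
        · exact (prod_rpow_le_det_weightedFrameOperator hv fun j => hpos j _).trans (le_abs_self _)
        · refine Real.exp_le_exp.2 ?_
          have := norm_sq_sum_smul_le_of_parseval hv fun j => S j (inner ℝ (v j) x)
          nlinarith [Real.pi_pos]
    _ = ∫⁻ y in Θ '' Set.univ, ENNReal.ofReal (Real.exp (-Real.pi * ‖y‖ ^ 2)) := by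
        rw [lintegral_image_eq_lintegral_abs_det_fderiv_mul volume MeasurableSet.univ
          (fun x _ => (hD x).hasFDerivWithinAt) hinj.injOn
          (fun y => ENNReal.ofReal (Real.exp (-Real.pi * ‖y‖ ^ 2))), Measure.restrict_univ]
    _ ≤ ∫⁻ y : E, ENNReal.ofReal (Real.exp (-Real.pi * ‖y‖ ^ 2)) := setLIntegral_le_lintegral _ _
    _ = 1 := lintegral_exp_neg_pi_mul_norm_sq

open MeasureTheory in
/-- Geometric rank-one Brascamp-Lieb inequality, for a Parseval frame `v` and positive continuous
functions. -/
theorem lintegral_prod_rpow_le_of_parseval [FiniteDimensional ℝ E] [MeasurableSpace E]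
    [BorelSpace E] {v : ι → E} (hv : ∀ w, ∑ j, inner ℝ (v j) w ^ 2 = ‖w‖ ^ 2)
    (hv0 : ∀ j, v j ≠ 0) {f : ι → ℝ → ℝ} (hfc : ∀ j, Continuous (f j))
    (hfpos : ∀ j x, 0 < f j x) (hfi : ∀ j, Integrable (f j)) :
    ∫⁻ x : E, ENNReal.ofReal (∏ j, f j (inner ℝ (v j) x) ^ (‖v j‖ ^ 2)) ≤
      ENNReal.ofReal (∏ j, ((∫ x, f j x) / ‖v j‖) ^ (‖v j‖ ^ 2)) := by
  have hd : ∀ j, 0 < ‖v j‖ := fun j => norm_pos_iff.2 (hv0 j)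
  have hJ : ∀ j, 0 < ∫ x, f j x := fun j =>
    (integral_pos_iff_support_of_nonneg (fun x => (hfpos j x).le) (hfi j)).2 (by
      have : Function.support (f j) = Set.univ :=
        Set.eq_univ_of_forall fun x => (hfpos j x).ne'
      simp [this])
  -- The Gaussian `exp (-π x²/‖v_j‖²)` has mass `‖v_j‖`, so `I j` equalises the masses; its
  -- `‖v_j‖²`-th power is the standard `exp (-π x²)`.
  let I : ι → ℝ := fun j => (∫ x, f j x) / ‖v j‖
  have hI : ∀ j, 0 < I j := fun j => div_pos (hJ j) (hd j)
  have hex : ∀ j, ∃ S S' : ℝ → ℝ, (∀ x, HasDerivAt S (S' x) x) ∧ (∀ x, 0 < S' x) ∧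
      ∀ x, f j x = I j * Real.exp (-(Real.pi / ‖v j‖ ^ 2) * S x ^ 2) * S' x := fun j => by
    have hb : 0 < Real.pi / ‖v j‖ ^ 2 := div_pos Real.pi_pos (pow_pos (hd j) 2)
    refine exists_monotone_transport (hfc j) (hfpos j) (hfi j)
      (g := fun x => I j * Real.exp (-(Real.pi / ‖v j‖ ^ 2) * x ^ 2)) (by fun_prop)
      (fun x => mul_pos (hI j) (Real.exp_pos _))
      ((integrable_exp_neg_mul_sq hb).const_mul _) ?_
    rw [integral_const_mul, integral_gaussian, div_div_cancel₀ Real.pi_ne_zero,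
      Real.sqrt_sq (hd j).le]
    exact (div_mul_cancel₀ _ (hd j).ne').symm
  choose S S' hS hpos hfS using hex
  calc _ = ∫⁻ x : E, ENNReal.ofReal (∏ j, I j ^ (‖v j‖ ^ 2)) * ENNReal.ofReal
        (∏ j, (Real.exp (-Real.pi * S j (inner ℝ (v j) x) ^ 2) *
          S' j (inner ℝ (v j) x) ^ (‖v j‖ ^ 2))) := by
        refine lintegral_congr fun x => ?_
        rw [← ENNReal.ofReal_mul (Finset.prod_nonneg fun j _ => Real.rpow_nonneg (hI j).le _),
          ← Finset.prod_mul_distrib]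
        congr 1
        refine Finset.prod_congr rfl fun j _ => ?_
        have := hd j
        rw [hfS, Real.mul_rpow (mul_pos (hI j) (Real.exp_pos _)).le (hpos _ _).le,
          Real.mul_rpow (hI j).le (Real.exp_pos _).le, ← Real.exp_mul, mul_assoc]
        congr 3
        field_simp
    _ = ENNReal.ofReal (∏ j, I j ^ (‖v j‖ ^ 2)) * ∫⁻ x : E, ENNReal.ofReal
        (∏ j, (Real.exp (-Real.pi * S j (inner ℝ (v j) x) ^ 2) *
          S' j (inner ℝ (v j) x) ^ (‖v j‖ ^ 2))) := lintegral_const_mul' _ _ ENNReal.ofReal_ne_top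
    _ ≤ ENNReal.ofReal (∏ j, I j ^ (‖v j‖ ^ 2)) * 1 := by
        gcongr
        exact lintegral_prod_exp_mul_rpow_le_one hv hS hpos
    _ = _ := mul_one _

end ParsevalFrame

/-! ### Fourier formula for the integral of `exp (-‖x‖₁)` over a subspace. -/

section FourierSection

open MeasureTheory Complex in
theorem integrable_exp_neg_abs : Integrable fun x : ℝ => Real.exp (-|x|) := by
  have h1 : IntegrableOn (fun x : ℝ => Real.exp (-|x|)) (Set.Ioi 0) :=
    (integrableOn_exp_neg_Ioi 0).congr_fun (fun x hx => by
      simp only [abs_of_pos (show 0 < x from hx)]) measurableSet_Ioi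
  have h2 : IntegrableOn (fun x : ℝ => Real.exp (-|x|)) (Set.Iic 0) :=
    integrableOn_exp_Iic 0 |>.congr_fun (fun x hx => by
      simp only [abs_of_nonpos (show x ≤ 0 from hx), neg_neg]) measurableSet_Iic
  rw [← integrableOn_univ, ← Set.Iic_union_Ioi (a := (0 : ℝ))]
  exact h2.union h1

open MeasureTheory Complex in
/-- The Fourier transform of `exp (-|x|)`. -/
theorem integral_cexp_mul_exp_neg_abs (a : ℝ) :
    ∫ x : ℝ, cexp ((a * x : ℝ) * I) * (Real.exp (-|x|) : ℂ) = ((2 / (1 + a ^ 2) : ℝ) : ℂ) := by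
  have hI : Integrable fun x : ℝ => cexp ((a * x : ℝ) * I) * (Real.exp (-|x|) : ℂ) := by
    refine integrable_exp_neg_abs.ofReal.bdd_mul (c := 1) (by fun_prop) ?_
    exact Filter.Eventually.of_forall fun x => by rw [norm_exp_ofReal_mul_I]
  have h1 : ∫ x in Set.Ioi (0 : ℝ), cexp ((a * x : ℝ) * I) * (Real.exp (-|x|) : ℂ) =
      1 / (1 - a * I) := by
    rw [setIntegral_congr_fun measurableSet_Ioi
      (g := fun x : ℝ => cexp ((a * I - 1) * x)) fun x hx => ?_,
      integral_exp_mul_complex_Ioi (by simp)]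
    · rw [← neg_sub (1 : ℂ), div_neg, neg_div, neg_neg]
      simp
    · simp only [abs_of_pos (show 0 < x from hx)]
      push_cast
      rw [← Complex.exp_add]
      ring_nf
  have h2 : ∫ x in Set.Iic (0 : ℝ), cexp ((a * x : ℝ) * I) * (Real.exp (-|x|) : ℂ) =
      1 / (1 + a * I) := by
    rw [setIntegral_congr_fun measurableSet_Iic
      (g := fun x : ℝ => cexp ((a * I + 1) * x)) fun x hx => ?_,
      integral_exp_mul_complex_Iic (by simp)]
    · simp [add_comm]
    · simp only [abs_of_nonpos (show x ≤ 0 from hx)]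
      push_cast
      rw [← Complex.exp_add]
      ring_nf
  rw [← intervalIntegral.integral_Iic_add_Ioi (b := (0 : ℝ)) hI.integrableOn hI.integrableOn,
    h1, h2]
  have h3 : (1 - a * I : ℂ) ≠ 0 := fun h => by simpa using congrArg re h
  have h4 : (1 + a * I : ℂ) ≠ 0 := fun h => by simpa using congrArg re h
  have h5 : (1 + a ^ 2 : ℂ) = (1 - a * I) * (1 + a * I) := by
    linear_combination (a ^ 2 : ℂ) * I_sq
  push_cast
  rw [h5]
  field_simp
  ring

variable {ι : Type*} [Fintype ι]

/-- The function `exp (-‖x‖₁)` on Euclidean space. -/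
noncomputable def expNegL1 (x : EuclideanSpace ℝ ι) : ℝ := Real.exp (-∑ i, |x i|)

theorem expNegL1_pos (x : EuclideanSpace ℝ ι) : 0 < expNegL1 x := Real.exp_pos _

theorem continuous_expNegL1 : Continuous (expNegL1 (ι := ι)) := by
  unfold expNegL1; fun_prop

theorem expNegL1_le (x y : EuclideanSpace ℝ ι) :
    expNegL1 x ≤ Real.exp (∑ i, |y i|) * expNegL1 (x + y) := by
  unfold expNegL1
  rw [← Real.exp_add]
  refine Real.exp_le_exp.2 ?_
  have : ∑ i, |(x + y) i| ≤ ∑ i, |x i| + ∑ i, |y i| := by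
    rw [← Finset.sum_add_distrib]
    exact Finset.sum_le_sum fun i _ => abs_add_le _ _
  have h2 : ∑ i, |x i| ≤ ∑ i, |(x + y) i| + ∑ i, |y i| := by
    rw [← Finset.sum_add_distrib]
    refine Finset.sum_le_sum fun i _ => ?_
    have := abs_sub ((x + y) i) (y i)
    simpa using this
  linarith

open MeasureTheory in
theorem integrable_expNegL1 : Integrable (expNegL1 (ι := ι)) := by
  have h := Integrable.fintype_prod (μ := fun _ : ι => (volume : Measure ℝ))
    (f := fun (_ : ι) x => Real.exp (-|x|)) fun _ => integrable_exp_neg_abs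
  have := (PiLp.volume_preserving_ofLp ι).integrable_comp_of_integrable h
  refine this.congr (Filter.Eventually.of_forall fun x => ?_)
  simp [expNegL1, ← Real.exp_sum]

open MeasureTheory Complex in
theorem integral_cexp_inner_mul_expNegL1 (w : EuclideanSpace ℝ ι) :
    ∫ z : EuclideanSpace ℝ ι, cexp ((-2 * Real.pi * inner ℝ z w : ℝ) * I) * (expNegL1 z : ℂ) =
      ((∏ j, 2 / (1 + (2 * Real.pi * w j) ^ 2) : ℝ) : ℂ) := by
  have h := integral_fintype_prod_volume_eq_prod (𝕜 := ℂ) (E := fun _ : ι => ℝ)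
    (fun j x => cexp ((-(2 * Real.pi * w j) * x : ℝ) * I) * (Real.exp (-|x|) : ℂ))
  simp only [integral_cexp_mul_exp_neg_abs, neg_sq] at h
  push_cast at h ⊢
  rw [← h, ← (PiLp.volume_preserving_ofLp ι).integral_comp
    (MeasurableEquiv.toLp 2 (ι → ℝ)).symm.measurableEmbedding]
  refine integral_congr_ae (Filter.Eventually.of_forall fun z => ?_)
  simp only [Finset.prod_mul_distrib, ← Complex.exp_sum]
  congr 1
  · congr 1
    simp only [PiLp.inner_apply]
    push_cast
    simp only [Finset.mul_sum, Finset.sum_mul]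
    refine Finset.sum_congr rfl fun j _ => ?_
    simp
    ring
  · simp [expNegL1]

variable (H : Submodule ℝ (EuclideanSpace ℝ ι))

open MeasureTheory in
/-- Orthogonal decomposition as a measure preserving equivalence. -/
theorem exists_measurableEquiv_prod_orthogonal :
    ∃ e : H × Hᗮ ≃ᵐ EuclideanSpace ℝ ι, MeasurePreserving e ∧ ∀ q, e q = q.1 + q.2 := by
  refine ⟨(H.measurableEquivProd (0 : EuclideanSpace ℝ ι)).symm, ?_, fun q => ?_⟩
  · have := (H.measurePreserving_measurableEquivProd (0 : EuclideanSpace ℝ ι)).symm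
    rwa [InnerProductSpace.euclideanHausdorffMeasure_eq_volume] at this
  · simp

-- Fubini gives integrability on almost every translate `H + y`; a single such `y` suffices, as
-- translation changes `expNegL1` by at most a constant factor.
open MeasureTheory in
theorem integrable_expNegL1_coe : Integrable fun x : H => expNegL1 (x : EuclideanSpace ℝ ι) := by
  obtain ⟨e, he, heq⟩ := exists_measurableEquiv_prod_orthogonal H
  have h := he.integrable_comp_of_integrable integrable_expNegL1
  obtain ⟨y, hy⟩ := (h.prod_left_ae).exists
  refine (hy.const_mul (Real.exp (∑ i, |(y : EuclideanSpace ℝ ι) i|))).mono'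
    (continuous_expNegL1.comp continuous_subtype_val).aestronglyMeasurable
    (Filter.Eventually.of_forall fun x => ?_)
  rw [Real.norm_of_nonneg (expNegL1_pos _).le]
  simpa [heq] using expNegL1_le (x : EuclideanSpace ℝ ι) y

-- The Fourier transform of the marginal `φ` on `Hᗮ` is the restriction to `Hᗮ` of the full
-- transform, a product of one-dimensional ones. Inversion at `0` recovers `φ 0`, the integral over
-- `H`.
open MeasureTheory Complex FourierTransform in
theorem integral_expNegL1_coe
    (hint : Integrable fun w : Hᗮ =>
      ∏ j, 2 / (1 + (2 * Real.pi * (w : EuclideanSpace ℝ ι) j) ^ 2)) :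
    ∫ x : H, expNegL1 (x : EuclideanSpace ℝ ι) =
      ∫ w : Hᗮ, ∏ j, 2 / (1 + (2 * Real.pi * (w : EuclideanSpace ℝ ι) j) ^ 2) := by
  obtain ⟨e, he, heq⟩ := exists_measurableEquiv_prod_orthogonal H
  let φ : Hᗮ → ℂ := fun y => ∫ x : H, (expNegL1 (x + y : EuclideanSpace ℝ ι) : ℂ)
  have hI : Integrable fun q : H × Hᗮ => (expNegL1 (q.1 + q.2 : EuclideanSpace ℝ ι) : ℂ) := by
    have := (he.integrable_comp_of_integrable integrable_expNegL1).ofReal (𝕜 := ℂ)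
    simpa [Function.comp_def, heq] using this
  have hφ : Integrable φ := hI.integral_prod_right
  -- Inversion at a point requires continuity there. For `‖y‖₁ < 1` the integrand is at most `e`
  -- times its value at `y = 0`.
  have hcont : ContinuousAt φ 0 := by
    refine continuousAt_of_dominated (bound := fun x : H => Real.exp 1 * expNegL1
      (x : EuclideanSpace ℝ ι)) (Filter.Eventually.of_forall fun y => ?_) ?_
      ((integrable_expNegL1_coe H).const_mul _) (Filter.Eventually.of_forall fun x => ?_)
    · have := continuous_expNegL1 (ι := ι)
      exact Continuous.aestronglyMeasurable (by fun_prop)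
    · have hc : Continuous fun y : Hᗮ => ∑ i, |(y : EuclideanSpace ℝ ι) i| := by fun_prop
      have h0 : (∑ i, |((0 : Hᗮ) : EuclideanSpace ℝ ι) i|) < 1 := by simp
      filter_upwards [hc.continuousAt.eventually (gt_mem_nhds h0)] with y hy
      refine Filter.Eventually.of_forall fun x => ?_
      rw [norm_real, Real.norm_of_nonneg (expNegL1_pos _).le]
      have := expNegL1_le (x + y : EuclideanSpace ℝ ι) (-y)
      rw [add_neg_cancel_right] at this
      refine this.trans (mul_le_mul_of_nonneg_right ?_ (expNegL1_pos _).le)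
      refine Real.exp_le_exp.2 ?_
      simpa using hy.le
    · have := continuous_expNegL1 (ι := ι)
      exact Continuous.continuousAt (by fun_prop)
  have hF : 𝓕 φ = fun w : Hᗮ =>
      ((∏ j, 2 / (1 + (2 * Real.pi * (w : EuclideanSpace ℝ ι) j) ^ 2) : ℝ) : ℂ) := by
    ext w
    have hI2 : Integrable fun q : H × Hᗮ => cexp ((-2 * Real.pi *
        inner ℝ (q.1 + q.2 : EuclideanSpace ℝ ι) w : ℝ) * I) *
          (expNegL1 (q.1 + q.2 : EuclideanSpace ℝ ι) : ℂ) := by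
      refine hI.bdd_mul (c := 1) (Continuous.aestronglyMeasurable (by fun_prop)) ?_
      exact Filter.Eventually.of_forall fun x => by rw [norm_exp_ofReal_mul_I]
    rw [← integral_cexp_inner_mul_expNegL1, ← he.integral_comp e.measurableEmbedding,
      Real.fourier_eq']
    simp only [heq]
    rw [Measure.volume_eq_prod, integral_prod_symm _ hI2]
    refine integral_congr_ae (Filter.Eventually.of_forall fun y => ?_)
    simp only [φ, smul_eq_mul]
    rw [← integral_const_mul]
    refine integral_congr_ae (Filter.Eventually.of_forall fun x => ?_)
    simp only
    -- The frequency lies in `Hᗮ`, so the phase does not depend on the `H`-component.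
    rw [inner_add_left, Submodule.inner_right_of_mem_orthogonal x.2 w.2, zero_add,
      Submodule.coe_inner]
  have hinv := hφ.fourierInv_fourier_eq (by rw [hF]; exact hint.ofReal) hcont
  rw [hF, Real.fourierInv_eq'] at hinv
  simp only [inner_zero_right, mul_zero, ofReal_zero, zero_mul, Complex.exp_zero, one_smul, φ,
    ZeroMemClass.coe_zero, add_zero] at hinv
  rw [integral_complex_ofReal, integral_complex_ofReal] at hinv
  exact (ofReal_injective hinv).symm

end FourierSection

/-! ### Volumes of sections of the cross-polytope. -/

section Volume

variable {ι : Type*} [Fintype ι]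

-- Injectivity of `L` makes `x ↦ ‖L x‖₁` a norm, and a norm's unit ball is measured by the integral
-- of `exp (-g)`. A general `L` covers both `H` and the whole space.
open MeasureTheory in
theorem volume_sum_abs_le_one {E : Type*} [NormedAddCommGroup E] [InnerProductSpace ℝ E]
    [FiniteDimensional ℝ E] [MeasurableSpace E] [BorelSpace E]
    {L : E →ₗ[ℝ] EuclideanSpace ℝ ι} (hL : Function.Injective L) :
    volume {x : E | ∑ i, |L x i| ≤ 1} =
      ENNReal.ofReal ((∫ x : E, expNegL1 (L x)) / Real.Gamma (Module.finrank ℝ E + 1)) := by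
  let g : E → ℝ := fun x => ∑ i, |L x i|
  have h1 : g 0 = 0 := by simp [g]
  have h2 : ∀ x, g (-x) = g x := fun x => by simp [g]
  have h3 : ∀ x y, g (x + y) ≤ g x + g y := fun x y => by
    simp only [g, ← Finset.sum_add_distrib, map_add]
    exact Finset.sum_le_sum fun i _ => abs_add_le _ _
  have h4 : ∀ {x}, g x = 0 → x = 0 := fun {x} hx => by
    have := (Finset.sum_eq_zero_iff_of_nonneg fun i _ => abs_nonneg _).1 hx
    refine hL ?_
    rw [map_zero]
    ext i
    simpa using this i (Finset.mem_univ i)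
  have h5 : ∀ (r : ℝ) x, g (r • x) ≤ |r| * g x := fun r x => by
    simp [g, abs_mul, Finset.mul_sum]
  have key := measure_lt_one_eq_integral_div_gamma volume h1 h2 h3 h4 h5 one_pos
  have hlt : volume {x : E | g x ≤ 1} = volume {x : E | g x < 1} := by
    -- The unit sphere is empty in the trivial space and null otherwise.
    rcases subsingleton_or_nontrivial E with hE | hE
    · congr 1
      ext x
      simp [Subsingleton.elim x 0, h1]
    · exact measure_le_eq_lt volume h1 h2 h3 h4 h5 1
  change volume {x : E | g x ≤ 1} = _
  rw [hlt, key]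
  simp [g, expNegL1]

theorem integral_expNegL1 :
    ∫ x : EuclideanSpace ℝ ι, expNegL1 x = 2 ^ Fintype.card ι := by
  have h := integral_cexp_inner_mul_expNegL1 (0 : EuclideanSpace ℝ ι)
  simp only [inner_zero_right, mul_zero, Complex.ofReal_zero, zero_mul, Complex.exp_zero, one_mul]
    at h
  rw [integral_complex_ofReal] at h
  rw [Complex.ofReal_injective h]
  simp

theorem volume_crossPolytope (k : ℕ) :
    MeasureTheory.volume (crossPolytope k) = ENNReal.ofReal (2 ^ k / Real.Gamma (k + 1)) := by
  have := volume_sum_abs_le_one (ι := Fin k) (L := LinearMap.id) Function.injective_id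
  simp only [LinearMap.id_coe, id, integral_expNegL1, Fintype.card_fin,
    finrank_euclideanSpace] at this
  exact this

open MeasureTheory in
theorem euclideanHausdorffMeasure_crossPolytope_inter {n : ℕ}
    (H : Submodule ℝ (EuclideanSpace ℝ (Fin n))) :
    (μHE[Module.finrank ℝ H] : Measure (EuclideanSpace ℝ (Fin n)))
        (crossPolytope n ∩ (H : Set (EuclideanSpace ℝ (Fin n)))) =
      ENNReal.ofReal ((∫ x : H, expNegL1 (x : EuclideanSpace ℝ (Fin n))) /
        Real.Gamma (Module.finrank ℝ H + 1)) := by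
  have h1 := (isometry_subtype_coe (s := (H : Set (EuclideanSpace ℝ (Fin n))))
    ).euclideanHausdorffMeasure_preimage (d := Module.finrank ℝ H) (crossPolytope n)
  rw [Subtype.range_coe] at h1
  refine h1.symm.trans ?_
  have h2 := InnerProductSpace.euclideanHausdorffMeasure_eq_volume (V := H)
  exact (congrArg (· (Subtype.val ⁻¹' crossPolytope n)) h2).trans
    (volume_sum_abs_le_one (L := H.subtype) H.injective_subtype)

end Volume

/-! ### The Parseval frame of projected basis vectors. -/

section Projection

variable {n : ℕ} (H : Submodule ℝ (EuclideanSpace ℝ (Fin n)))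

/-- The projections of the standard basis vectors onto `Hᗮ`. -/
noncomputable def projSingle (j : Fin n) : Hᗮ :=
  Hᗮ.orthogonalProjectionOnto (EuclideanSpace.single j (1 : ℝ))

theorem inner_projSingle (j : Fin n) (w : Hᗮ) :
    inner ℝ (projSingle H j) w = (w : EuclideanSpace ℝ (Fin n)) j := by
  rw [projSingle, Submodule.inner_orthogonalProjectionOnto_eq_of_mem_right]
  simp [EuclideanSpace.inner_single_left]

theorem norm_projSingle (j : Fin n) : ‖projSingle H j‖ = projPerpNorm H j := rfl

theorem sum_inner_projSingle_sq (w : Hᗮ) :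
    ∑ j, inner ℝ (projSingle H j) w ^ 2 = ‖w‖ ^ 2 := by
  simp only [inner_projSingle]
  rw [Submodule.coe_norm, EuclideanSpace.norm_sq_eq]
  simp

/-- Both sides are the trace of the projection onto `Hᗮ`: exchange the sums over the frame and over
an orthonormal basis. -/
theorem sum_projPerpNorm_sq {k : ℕ} (hk : Module.finrank ℝ H = k) :
    ∑ j, projPerpNorm H j ^ 2 = (n : ℝ) - k := by
  have b := stdOrthonormalBasis ℝ Hᗮ
  have h1 : ∀ j, projPerpNorm H j ^ 2 = ∑ i, inner ℝ (projSingle H j) (b i) ^ 2 := fun j => by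
    rw [b.sum_sq_inner_left, norm_projSingle]
  simp only [h1]
  rw [Finset.sum_comm]
  simp only [sum_inner_projSingle_sq, b.orthonormal.1]
  have h2 := H.finrank_add_finrank_orthogonal
  rw [hk, finrank_euclideanSpace, Fintype.card_fin] at h2
  simp only [one_pow, Finset.sum_const, Finset.card_univ, Fintype.card_fin, nsmul_eq_mul, mul_one]
  have h3 : (k : ℝ) + Module.finrank ℝ Hᗮ = n := by exact_mod_cast h2
  linarith

theorem projPerpNorm_le_one (j : Fin n) : projPerpNorm H j ≤ 1 := by
  have := Hᗮ.norm_starProjection_apply_le (EuclideanSpace.single j (1 : ℝ))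
  simpa [projPerpNorm] using this

theorem projPerpNorm_pos {j : Fin n} (hj : EuclideanSpace.single j (1 : ℝ) ∉ H) :
    0 < projPerpNorm H j := by
  refine norm_pos_iff.2 fun h => hj ?_
  rw [Submodule.starProjection_apply_eq_zero_iff, Submodule.orthogonal_orthogonal] at h
  exact h

end Projection

/-! ### Brascamp-Lieb applied to the Fourier integral. -/

section Bound

variable {n k : ℕ} (H : Submodule ℝ (EuclideanSpace ℝ (Fin n)))

/-- `∫ (1 + d_j² x²)^(-1/d_j²) dx`, where `d_j = projPerpNorm H j`. -/
noncomputable def gammaRatio (j : Fin n) : ℝ :=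
  √Real.pi * (Real.Gamma (1 / projPerpNorm H j ^ 2 - 1 / 2) /
    (projPerpNorm H j * Real.Gamma (1 / projPerpNorm H j ^ 2)))

theorem half_lt_one_div_sq {d : ℝ} (hd : 0 < d) (hd1 : d ≤ 1) : 1 / 2 < 1 / d ^ 2 := by
  have hd2 : 0 < d ^ 2 := by positivity
  rw [div_lt_div_iff₀ two_pos hd2]
  nlinarith

theorem gammaRatio_pos {j : Fin n} (hd : 0 < projPerpNorm H j) : 0 < gammaRatio H j := by
  have h := half_lt_one_div_sq hd (projPerpNorm_le_one H j)
  have h1 := Real.Gamma_pos_of_pos (sub_pos.2 h)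
  have h2 := Real.Gamma_pos_of_pos (by linarith : 0 < 1 / projPerpNorm H j ^ 2)
  unfold gammaRatio
  have := Real.pi_pos
  positivity

/-- The identity `∑ d_j² = n - k` distributes the prefactor among the factors as `(1/√π)^(d_j²)`. -/
theorem sectionFactor_eq_prod (hk : Module.finrank ℝ H = k) (hd : ∀ j, 0 < projPerpNorm H j) :
    sectionFactor k H = ∏ j, (gammaRatio H j / Real.pi) ^ (projPerpNorm H j ^ 2) := by
  have hπ := Real.pi_pos
  have h1 : ∏ j : Fin n, (1 / √Real.pi) ^ (projPerpNorm H j ^ 2) =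
      1 / Real.pi ^ (((n : ℝ) - (k : ℝ)) / 2) := by
    rw [← Real.rpow_sum_of_pos (by positivity), sum_projPerpNorm_sq H hk,
      Real.div_rpow zero_le_one (by positivity), Real.one_rpow, Real.sqrt_eq_rpow,
      ← Real.rpow_mul hπ.le]
    ring_nf
  rw [sectionFactor, ← h1, ← Finset.prod_mul_distrib]
  refine Finset.prod_congr rfl fun j _ => ?_
  have hpos := gammaRatio_pos H (hd j)
  have hq : Real.Gamma (1 / projPerpNorm H j ^ 2 - 1 / 2) /
      (projPerpNorm H j * Real.Gamma (1 / projPerpNorm H j ^ 2)) = gammaRatio H j / √Real.pi := by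
    rw [gammaRatio, mul_div_cancel_left₀ _ (by positivity)]
  rw [hq, ← Real.mul_rpow (by positivity) (by positivity)]
  congr 1
  nth_rewrite 3 [← Real.mul_self_sqrt hπ.le]
  field_simp

theorem sectionFactor_le_one (hk : Module.finrank ℝ H = k) (hd : ∀ j, 0 < projPerpNorm H j) :
    sectionFactor k H ≤ 1 := by
  rw [sectionFactor_eq_prod H hk hd]
  refine Finset.prod_le_one (fun j _ => Real.rpow_nonneg
    (div_pos (gammaRatio_pos H (hd j)) Real.pi_pos).le _) fun j _ => ?_
  refine Real.rpow_le_one (div_pos (gammaRatio_pos H (hd j)) Real.pi_pos).le ?_ (sq_nonneg _)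
  exact (div_le_one Real.pi_pos).2 (sqrt_pi_mul_gamma_div_le_pi (hd j) (projPerpNorm_le_one H j))

open MeasureTheory in
theorem lintegral_prod_two_div_le (hk : Module.finrank ℝ H = k)
    (hd : ∀ j, 0 < projPerpNorm H j) :
    ∫⁻ w : Hᗮ, ENNReal.ofReal
        (∏ j, 2 / (1 + (2 * Real.pi * (w : EuclideanSpace ℝ (Fin n)) j) ^ 2)) ≤
      ENNReal.ofReal (2 ^ k * sectionFactor k H) := by
  have hπ := Real.pi_pos
  let p : Fin n → ℝ := fun j => 1 / projPerpNorm H j ^ 2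
  have hp : ∀ j, 1 / 2 < p j := fun j => half_lt_one_div_sq (hd j) (projPerpNorm_le_one H j)
  -- The exponent `1/d_j²` is chosen so that `f_j ^ (d_j²)` is the factor `1/(1 + (2π s)²)`.
  let f : Fin n → ℝ → ℝ := fun j s => (1 + (2 * Real.pi * s) ^ 2) ^ (-(p j))
  have hf : ∀ j, Integrable (f j) := fun j =>
    (integrable_one_add_sq_rpow_neg (hp j)).comp_mul_left' (by positivity)
  have hfint : ∀ j, ∫ x, f j x = (2 * Real.pi)⁻¹ *
      (√Real.pi * Real.Gamma (p j - 1 / 2) / Real.Gamma (p j)) := fun j => by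
    simp only [f]
    rw [Measure.integral_comp_mul_left (fun x : ℝ => (1 + x ^ 2) ^ (-(p j))) (2 * Real.pi),
      integral_one_add_sq_rpow_neg (hp j), abs_of_pos (by positivity), smul_eq_mul]
  have hBL := lintegral_prod_rpow_le_of_parseval (sum_inner_projSingle_sq H)
    (fun j => norm_pos_iff.1 (hd j)) (f := f)
    (fun j => (continuous_one_add_sq_rpow _).comp (by fun_prop))
    (fun j x => Real.rpow_pos_of_pos (by positivity) _) hf
  simp only [norm_projSingle, inner_projSingle] at hBL
  -- The halves come from the rescaling by `2π` in each `∫ f_j`; they cancel `2^(n-k)` of the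
  -- numerators' `2^n`.
  have h2 : (2 : ℝ) ^ n * ∏ j : Fin n, (2 : ℝ)⁻¹ ^ (projPerpNorm H j ^ 2) = 2 ^ k := by
    rw [← Real.rpow_sum_of_pos (by positivity), sum_projPerpNorm_sq H hk,
      Real.inv_rpow two_pos.le, ← Real.rpow_neg two_pos.le, ← Real.rpow_natCast,
      ← Real.rpow_add two_pos, ← Real.rpow_natCast]
    ring_nf
  calc _ = ∫⁻ w : Hᗮ, ENNReal.ofReal (2 ^ n) * ENNReal.ofReal
        (∏ j, f j ((w : EuclideanSpace ℝ (Fin n)) j) ^ (projPerpNorm H j ^ 2)) := by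
        refine lintegral_congr fun w => ?_
        rw [← ENNReal.ofReal_mul (by positivity)]
        congr 1
        simp only [div_eq_mul_inv, Finset.prod_mul_distrib, Finset.prod_const, Finset.card_univ,
          Fintype.card_fin]
        congr 1
        refine Finset.prod_congr rfl fun j _ => ?_
        have hj := hd j
        simp only [f, p]
        rw [← Real.rpow_mul (by positivity), neg_mul, one_div, inv_mul_cancel₀ (by positivity),
          Real.rpow_neg_one]
    _ = ENNReal.ofReal (2 ^ n) * ∫⁻ w : Hᗮ, ENNReal.ofReal
        (∏ j, f j ((w : EuclideanSpace ℝ (Fin n)) j) ^ (projPerpNorm H j ^ 2)) :=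
        lintegral_const_mul' _ _ ENNReal.ofReal_ne_top
    _ ≤ ENNReal.ofReal (2 ^ n) * ENNReal.ofReal
        (∏ j, ((∫ x, f j x) / projPerpNorm H j) ^ (projPerpNorm H j ^ 2)) := by gcongr
    _ = _ := by
        rw [← ENNReal.ofReal_mul (by positivity), sectionFactor_eq_prod H hk hd, ← h2, mul_assoc,
          ← Finset.prod_mul_distrib]
        congr 2
        refine Finset.prod_congr rfl fun j _ => ?_
        have hpos := gammaRatio_pos H (hd j)
        have hj := hd j
        rw [← Real.mul_rpow (by positivity) (by positivity), hfint]
        congr 1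
        simp only [gammaRatio, p]
        field_simp

open MeasureTheory in
theorem integral_expNegL1_coe_le (hk : Module.finrank ℝ H = k)
    (hd : ∀ j, 0 < projPerpNorm H j) :
    ∫ x : H, expNegL1 (x : EuclideanSpace ℝ (Fin n)) ≤ 2 ^ k * sectionFactor k H := by
  have hle := lintegral_prod_two_div_le H hk hd
  have hnn : ∀ w : Hᗮ, 0 ≤ ∏ j, 2 / (1 + (2 * Real.pi * (w : EuclideanSpace ℝ (Fin n)) j) ^ 2) :=
    fun w => Finset.prod_nonneg fun j _ => by positivity
  have hm : AEStronglyMeasurable (fun w : Hᗮ =>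
      ∏ j, 2 / (1 + (2 * Real.pi * (w : EuclideanSpace ℝ (Fin n)) j) ^ 2)) := by
    refine Continuous.aestronglyMeasurable (continuous_finsetProd _ fun j _ => ?_)
    exact Continuous.div (by fun_prop) (by fun_prop) fun w => by positivity
  have hint : Integrable fun w : Hᗮ =>
      ∏ j, 2 / (1 + (2 * Real.pi * (w : EuclideanSpace ℝ (Fin n)) j) ^ 2) := by
    refine ⟨hm, ?_⟩
    rw [hasFiniteIntegral_iff_ofReal (Filter.Eventually.of_forall hnn)]
    exact hle.trans_lt ENNReal.ofReal_lt_top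
  have hs : 0 ≤ sectionFactor k H := by
    rw [sectionFactor_eq_prod H hk hd]
    exact Finset.prod_nonneg fun j _ => Real.rpow_nonneg
      (div_pos (gammaRatio_pos H (hd j)) Real.pi_pos).le _
  rw [integral_expNegL1_coe H hint,
    integral_eq_lintegral_of_nonneg_ae (Filter.Eventually.of_forall hnn) hm]
  exact ENNReal.toReal_le_of_le_ofReal (by positivity) hle

end Bound

theorem corollary5p10 (n k : ℕ) (H : Submodule ℝ (EuclideanSpace ℝ (Fin n)))
    (hk : Module.finrank ℝ H = k)
    (hH : ∀ j : Fin n, EuclideanSpace.single j (1 : ℝ) ∉ H ∧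
      EuclideanSpace.single j (1 : ℝ) ∉ Hᗮ) :
    (μHE[k] : MeasureTheory.Measure (EuclideanSpace ℝ (Fin n)))
        (crossPolytope n ∩ (H : Set (EuclideanSpace ℝ (Fin n)))) ≤
      MeasureTheory.volume (crossPolytope k) * ENNReal.ofReal (sectionFactor k H) ∧
    MeasureTheory.volume (crossPolytope k) * ENNReal.ofReal (sectionFactor k H) ≤
      MeasureTheory.volume (crossPolytope k) := by
  have hd : ∀ j, 0 < projPerpNorm H j := fun j => projPerpNorm_pos H (hH j).1
  have hΓ : 0 < Real.Gamma (k + 1) := Real.Gamma_pos_of_pos (by positivity)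
  refine ⟨?_, mul_le_of_le_one_right' (ENNReal.ofReal_le_one.2 (sectionFactor_le_one H hk hd))⟩
  have h := euclideanHausdorffMeasure_crossPolytope_inter H
  rw [hk] at h
  rw [h, volume_crossPolytope, ← ENNReal.ofReal_mul (by positivity), div_mul_eq_mul_div]
  exact ENNReal.ofReal_le_ofReal
    (div_le_div_of_nonneg_right (integral_expNegL1_coe_le H hk hd) hΓ.le)
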